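/- Let $H$ be an infinite-dimensional real separable Hilbert space. A dictionary in $H$ is a set ${\cal D}\subset H$ of unit vectors whose closed linear span is $H$; its cumulative coherence is $$\mu_1({\cal D}):=\sup_{g\in{\cal D}}\ \sum_{\tilde g\in{\cal D},\ \tilde g\neq g}|\langle\tilde g,g\rangle|\in[0,\infty].$$ A realization of the Pure Greedy Algorithm (PGA) for $f\in H$ with respect to ${\cal D}$ is given by $G_0:=0$, $f_0:=f$ and, for every $m\ge 0$, the choice of an element $g_{m+1}\in{\cal D}$ with $|\langle f_m,g_{m+1}\rangle|=\sup_{g\in{\cal D}}|\langle f_m,g\rangle|$, followed by $G_{m+1}:=G_m+\langle f_m,g_{m+1}\rangle g_{m+1}$ and $f_{m+1}:=f-G_{m+1}$; one writes $G_m^{PGA}(f,{\cal D}):=G_m$. Then there exist a dictionary ${\cal D}$ in $H$ with $\mu_1({\cal D})<\infty$, a finite linear combination $f_0$ of elements of ${\cal D}$, and constants $\beta>0$ and $C>0$ such that the PGA for $f_0$ with respect to ${\cal D}$ has a realization, and every realization satisfies $$\|f_0-G_m^{PGA}(f_0,{\cal D})\|\ \ge\ C\,m^{-1/2+\beta}\qquad\text{for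 all } m\ge 1 .$$ -/

import Mathlib

open scoped ENNReal

/-- A dictionary in a real inner product space: a set of unit vectors whose linear span is dense. -/
structure IsDictionary {H : Type*} [NormedAddCommGroup H] [InnerProductSpace ℝ H]
    (D : Set H) : Prop where
  norm_eq_one : ∀ g ∈ D, ‖g‖ = 1
  dense_span : (Submodule.span ℝ D).topologicalClosure = ⊤

/-- The cumulative coherence `μ₁(D) = sup_{g ∈ D} ∑_{g' ∈ D, g' ≠ g} |⟨g', g⟩|`,
as an extended nonnegative real number. -/
noncomputable def cumulativeCoherence {H : Type*} [NormedAddCommGroup H] [InnerProductSpace ℝ H]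
    (D : Set H) : ℝ≥0∞ :=
  ⨆ g ∈ D, ∑' g' : {x : H // x ∈ D ∧ x ≠ g}, ENNReal.ofReal |inner ℝ (g' : H) g|

/-- The class `A₀(D)` of finite linear combinations of elements of `D`. -/
def finiteCombinations {H : Type*} [NormedAddCommGroup H] [InnerProductSpace ℝ H]
    (D : Set H) : Set H :=
  (Submodule.span ℝ D : Set H)

/-- The approximants `G_m` of the Pure Greedy Algorithm applied to `f`, when `g m` is the
element selected at step `m + 1`. The residual after `m` steps is `f - pgaApprox f g m`. -/
noncomputable def pgaApprox {H : Type*} [NormedAddCommGroup H] [InnerProductSpace ℝ H]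
    (f : H) (g : ℕ → H) : ℕ → H
  | 0 => 0
  | m + 1 => pgaApprox f g m + (inner ℝ (f - pgaApprox f g m) (g m) : ℝ) • g m

/-- `g` is an admissible sequence of choices of the Pure Greedy Algorithm for `f` with respect
to `D`: `g m` is an element of `D` at which `sup_{h ∈ D} |⟨f_m, h⟩|` is attained, where
`f_m = f - G_m` is the residual after `m` steps. -/
def IsPGASelection {H : Type*} [NormedAddCommGroup H] [InnerProductSpace ℝ H]
    (D : Set H) (f : H) (g : ℕ → H) : Prop :=
  ∀ m : ℕ, g m ∈ D ∧
    ∀ h ∈ D, |inner ℝ (f - pgaApprox f g m) h| ≤ |inner ℝ (f - pgaApprox f g m) (g m)|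

section Orthonormal

variable {H : Type*} [NormedAddCommGroup H] [InnerProductSpace ℝ H]

lemma exists_orthonormal_of_not_finiteDimensional [CompleteSpace H]
    (hH : ¬ FiniteDimensional ℝ H) (ι : Type*) [Countable ι] :
    ∃ b : ι → H, Orthonormal ℝ b := by
  obtain ⟨s, b, hb⟩ := exists_hilbertBasis ℝ H
  have hs : Infinite s := by
    by_contra hfin
    rw [not_infinite_iff_finite] at hfin
    have := Fintype.ofFinite s
    exact hH (b.toOrthonormalBasis.toBasis.finiteDimensional_of_finite)
  obtain ⟨φ, hφ⟩ := Countable.exists_injective_nat ι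
  exact ⟨_, b.orthonormal.comp _ ((Infinite.natEmbedding s).injective.comp hφ)⟩

/-- The autoregressive sequence with coefficients `κ`, `c` driven by `E`. -/
noncomputable def autoregressive (κ c : ℝ) (E : ℕ → H) : ℕ → H
  | 0 => E 0
  | n + 1 => κ • autoregressive κ c E n + c • E (n + 1)

lemma inner_autoregressive_of_forall {κ c : ℝ} {E : ℕ → H} {v : H}
    (h : ∀ n, inner ℝ (E n) v = 0) (n : ℕ) : inner ℝ (autoregressive κ c E n) v = 0 := by
  induction n with
  | zero => exact h 0
  | succ n ih => simp [autoregressive, inner_add_left, inner_smul_left, ih, h]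

lemma inner_autoregressive_future {κ c : ℝ} {E : ℕ → H} (hE : Orthonormal ℝ E) {n j : ℕ}
    (h : n < j) : inner ℝ (autoregressive κ c E n) (E j) = 0 := by
  induction n with
  | zero => exact hE.2 h.ne
  | succ n ih =>
    simp [autoregressive, inner_add_left, inner_smul_left, ih (by omega), hE.2 h.ne]

lemma inner_autoregressive_past {κ c : ℝ} {E : ℕ → H} (hE : Orthonormal ℝ E) (n s : ℕ) :
    inner ℝ (E (n + 1)) (autoregressive κ c E (n + 1 + s)) = c * κ ^ s := by
  induction s with
  | zero =>
    have h := inner_autoregressive_future (κ := κ) (c := c) hE (Nat.lt_succ_self n)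
    rw [real_inner_comm] at h
    simp [autoregressive, inner_add_right, inner_smul_right, h, hE.1]
  | succ s ih =>
    have h : inner ℝ (E (n + 1)) (E (n + 1 + s + 1)) = (0 : ℝ) := hE.2 (by omega)
    rw [← add_assoc]
    simp only [autoregressive, inner_add_right, inner_smul_right, ih, h]
    ring

lemma inner_autoregressive_self {κ c : ℝ} (hκ : κ ^ 2 + c ^ 2 = 1) {E : ℕ → H}
    (hE : Orthonormal ℝ E) (n s : ℕ) :
    inner ℝ (autoregressive κ c E n) (autoregressive κ c E (n + s)) = κ ^ s := by
  induction s with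
  | zero =>
    induction n with
    | zero => simp [autoregressive, hE.1]
    | succ n ih =>
      have h := inner_autoregressive_future (κ := κ) (c := c) hE (Nat.lt_succ_self n)
      have h' := h
      rw [real_inner_comm] at h'
      simp only [add_zero] at ih
      have h1 : inner ℝ (E (n + 1)) (E (n + 1)) = (1 : ℝ) := by simp [hE.1]
      simp only [autoregressive, inner_add_right, inner_add_left, inner_smul_right,
        inner_smul_left, ih, h, h', h1]
      simp
      linarith
  | succ s ih =>
    have h := inner_autoregressive_future (κ := κ) (c := c) hE (show n < n + s + 1 by omega)
    rw [← add_assoc]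
    simp only [autoregressive, inner_add_right, inner_smul_right, ih, h]
    ring

/-- The prescribed inner products of two level vectors at a given distance. -/
noncomputable def lagCorr : ℕ → ℝ
  | 0 => 1
  | 1 => 25 / 504
  | s + 2 => -(305 / 4536) * (4 / 9) ^ s

lemma exists_sequence_inner_eq_lagCorr {b : ℕ ⊕ ℕ ⊕ ℕ → H} (hb : Orthonormal ℝ b) :
    ∃ U : ℕ → H, (∀ n, U n ∈ Submodule.span ℝ (Set.range b)) ∧
      ∀ n s, inner ℝ (U n) (U (n + s)) = lagCorr s := by
  set E : ℕ → H := fun n => b (.inl n) with hE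
  set P : ℕ → H := fun n => b (.inr (.inl n)) with hP
  set W : ℕ → H := fun n => b (.inr (.inr n)) with hW
  have oE : Orthonormal ℝ E := hb.comp _ Sum.inl_injective
  have oP : Orthonormal ℝ P := hb.comp _ (Sum.inr_injective.comp Sum.inl_injective)
  have oW : Orthonormal ℝ W := hb.comp _ (Sum.inr_injective.comp Sum.inr_injective)
  have EP : ∀ i j, inner ℝ (E i) (P j) = (0 : ℝ) := fun i j => hb.2 (by simp)
  have EW : ∀ i j, inner ℝ (E i) (W j) = (0 : ℝ) := fun i j => hb.2 (by simp)
  have PW : ∀ i j, inner ℝ (P i) (W j) = (0 : ℝ) := fun i j => hb.2 (by simp)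
  have PE : ∀ i j, inner ℝ (P i) (E j) = (0 : ℝ) := fun i j => hb.2 (by simp)
  have WE : ∀ i j, inner ℝ (W i) (E j) = (0 : ℝ) := fun i j => hb.2 (by simp)
  have WP : ∀ i j, inner ℝ (W i) (P j) = (0 : ℝ) := fun i j => hb.2 (by simp)
  obtain ⟨c, hc0, hc⟩ : ∃ c : ℝ, c ≠ 0 ∧ c ^ 2 = 65 / 81 :=
    ⟨√(65 / 81), by positivity, Real.sq_sqrt (by norm_num)⟩
  obtain ⟨α, hα⟩ : ∃ α : ℝ, α ^ 2 = 45 / 224 := ⟨√(45 / 224), Real.sq_sqrt (by norm_num)⟩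
  obtain ⟨γ, hγ⟩ : ∃ γ : ℝ, γ ^ 2 = 1 - (9 / 64 + (431 / 756) ^ 2 * (81 / 65) + 45 / 112) :=
    ⟨√_, Real.sq_sqrt (by norm_num)⟩
  set Y := autoregressive (4 / 9) c E with hY
  have hκ : (4 / 9 : ℝ) ^ 2 + c ^ 2 = 1 := by rw [hc]; norm_num
  have YP : ∀ i j, inner ℝ (Y i) (P j) = (0 : ℝ) := fun i j =>
    inner_autoregressive_of_forall (fun n => EP n j) i
  have YW : ∀ i j, inner ℝ (Y i) (W j) = (0 : ℝ) := fun i j =>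
    inner_autoregressive_of_forall (fun n => EW n j) i
  have PY : ∀ i j, inner ℝ (P i) (Y j) = (0 : ℝ) := fun i j => by rw [real_inner_comm, YP]
  have WY : ∀ i j, inner ℝ (W i) (Y j) = (0 : ℝ) := fun i j => by rw [real_inner_comm, YW]
  have YY : ∀ n s, inner ℝ (Y n) (Y (n + s)) = (4 / 9 : ℝ) ^ s := inner_autoregressive_self hκ oE
  have EY : ∀ n s, inner ℝ (E (n + 1)) (Y (n + 1 + s)) = c * (4 / 9 : ℝ) ^ s :=
    inner_autoregressive_past oE
  have YE : ∀ n j, n < j → inner ℝ (Y n) (E j) = (0 : ℝ) := fun n j h =>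
    inner_autoregressive_future oE h
  have memE : ∀ n, E n ∈ Submodule.span ℝ (Set.range b) := fun n =>
    Submodule.subset_span ⟨_, rfl⟩
  have memP : ∀ n, P n ∈ Submodule.span ℝ (Set.range b) := fun n =>
    Submodule.subset_span ⟨_, rfl⟩
  have memW : ∀ n, W n ∈ Submodule.span ℝ (Set.range b) := fun n =>
    Submodule.subset_span ⟨_, rfl⟩
  have memY : ∀ n, Y n ∈ Submodule.span ℝ (Set.range b) := fun n => by
    induction n with
    | zero => exact memE 0
    | succ n ih =>
      exact Submodule.add_mem _ (Submodule.smul_mem _ _ ih) (Submodule.smul_mem _ _ (memE _))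
  have EE : ∀ i j, inner ℝ (E i) (E j) = if i = j then (1 : ℝ) else 0 :=
    orthonormal_iff_ite.1 oE
  have PP : ∀ i j, inner ℝ (P i) (P j) = if i = j then (1 : ℝ) else 0 :=
    orthonormal_iff_ite.1 oP
  have WW : ∀ i j, inner ℝ (W i) (W j) = if i = j then (1 : ℝ) else 0 :=
    orthonormal_iff_ite.1 oW
  refine ⟨fun n => ((-3 / 8 : ℝ) • Y n + (431 / 756 / c) • E (n + 1)) +
    (α • P n + α • P (n + 1)) + γ • W n, fun n => ?_, fun n s => ?_⟩
  · exact add_mem (add_mem (add_mem (Submodule.smul_mem _ _ (memY _))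
      (Submodule.smul_mem _ _ (memE _))) (add_mem (Submodule.smul_mem _ _ (memP _))
      (Submodule.smul_mem _ _ (memP _)))) (Submodule.smul_mem _ _ (memW _))
  · have hz : (431 / 756 / c) * (431 / 756 / c) = (431 / 756) ^ 2 * (81 / 65) := by
      rw [div_mul_div_comm, ← pow_two c, hc]; norm_num
    have YE' := YE n (n + s + 1) (by omega)
    simp only [inner_add_left, inner_add_right, inner_smul_left, inner_smul_right, YP, YW, PY, WY,
      EP, EW, PW, PE, WE, WP, YY, YE', EE, PP, WW]
    match s with
    | 0 =>
      have h := YE n (n + 1) (by omega)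
      rw [real_inner_comm] at h
      simp [lagCorr, h]
      linear_combination hz + 2 * hα + hγ
    | 1 =>
      have h := EY n 0
      simp only [add_zero, pow_zero, mul_one] at h
      have hn : n ≠ n + 1 + 1 := by omega
      have h' : (431 / 756 / c) * c = 431 / 756 := by field_simp
      simp [lagCorr, h, hn]
      linear_combination (-3 / 8 : ℝ) * h' + hα
    | s + 2 =>
      have h := EY n (s + 1)
      rw [show n + 1 + (s + 1) = n + (s + 2) by ring] at h
      have hn : n ≠ n + (s + 2) + 1 := by omega
      have h' : (431 / 756 / c) * c = 431 / 756 := by field_simp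
      simp [lagCorr, h, hn]
      linear_combination (-3 / 8 : ℝ) * (4 / 9) ^ (s + 1) * h'

end Orthonormal

section LevelSystem

open Filter Topology

variable {H : Type*} [NormedAddCommGroup H] [InnerProductSpace ℝ H]

/-- Level vectors `U` with prescribed mutual inner products, an orthonormal family `e` with `4 ^ l`
members on level `l`, and a unit vector `v`, all orthogonal to one another. -/
structure IsLevelSystem (U : ℕ → H) (e : (Σ l : ℕ, Fin (4 ^ l)) → H) (v : H) : Prop where
  inner_add : ∀ n s, inner ℝ (U n) (U (n + s)) = lagCorr s
  orthonormal : Orthonormal ℝ e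
  inner_e_U : ∀ p n, inner ℝ (e p) (U n) = 0
  norm_v : ‖v‖ = 1
  inner_v_U : ∀ n, inner ℝ v (U n) = 0
  inner_v_e : ∀ p, inner ℝ v (e p) = 0

lemma exists_isLevelSystem [CompleteSpace H] (hH : ¬ FiniteDimensional ℝ H) :
    ∃ (U : ℕ → H) (e : (Σ l : ℕ, Fin (4 ^ l)) → H) (v : H), IsLevelSystem U e v := by
  obtain ⟨b, hb⟩ := exists_orthonormal_of_not_finiteDimensional hH
    (Unit ⊕ (Σ l : ℕ, Fin (4 ^ l)) ⊕ (ℕ ⊕ ℕ ⊕ ℕ))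
  obtain ⟨U, hU, hUU⟩ := exists_sequence_inner_eq_lagCorr
    (b := fun i => b (.inr (.inr i))) (hb.comp _ (Sum.inr_injective.comp Sum.inr_injective))
  have key : ∀ x : H, (∀ i, inner ℝ x (b (.inr (.inr i))) = 0) → ∀ n, inner ℝ x (U n) = 0 := by
    intro x hx n
    have hn := hU n
    generalize U n = u at hn
    induction hn using Submodule.span_induction with
    | mem y hy => obtain ⟨i, rfl⟩ := hy; exact hx i
    | zero => simp
    | add y z _ _ hy hz => rw [inner_add_right, hy, hz, add_zero]
    | smul c y _ hy => rw [inner_smul_right, hy, mul_zero]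
  exact ⟨U, fun p => b (.inr (.inl p)), b (.inl ()), hUU,
    hb.comp _ (Sum.inr_injective.comp Sum.inl_injective),
    fun p => key _ fun i => hb.2 (by simp), hb.1 _, key _ fun i => hb.2 (by simp),
    fun p => hb.2 (by simp)⟩

/-- The `i`-th dictionary element on level `l`. -/
noncomputable def levelElement (U : ℕ → H) (e : (Σ l : ℕ, Fin (4 ^ l)) → H) (l : ℕ)
    (i : Fin (4 ^ l)) : H :=
  (e ⟨l, i⟩ - (4 ^ l : ℝ)⁻¹ • ∑ j, e ⟨l, j⟩) + (2 ^ l : ℝ)⁻¹ • U l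

/-- The sum of the first `m` levels of the target vector. -/
noncomputable def partialTarget (U : ℕ → H) (m : ℕ) : H :=
  ∑ l ∈ Finset.range m, (5 / 9 : ℝ) ^ l • U l

/-- The vector to be approximated. -/
noncomputable def target (U : ℕ → H) : H := ∑' l, (5 / 9 : ℝ) ^ l • U l

/-- The approximant obtained from all levels below `m` and the elements of level `m` in `S`. -/
noncomputable def stateApprox (U : ℕ → H) (e : (Σ l : ℕ, Fin (4 ^ l)) → H) (m : ℕ)
    (S : Finset (Fin (4 ^ m))) : H :=
  partialTarget U m + (5 / 18 : ℝ) ^ m • ∑ i ∈ S, levelElement U e m i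

/-- The inner product of `target U - partialTarget U m` with `U k`. -/
noncomputable def levelCorr (m k : ℕ) : ℝ :=
  if k < m then if k + 1 = m then 0 else -(5 / 56) * (4 / 9) ^ (m - k - 2) * (5 / 9) ^ m
  else if k = m then (5 / 9) ^ m else 305 / 504 * (4 / 9) ^ (k - m - 1) * (5 / 9) ^ m

/-- The inner product of `target U - partialTarget U m` with `target U`. -/
noncomputable def targetCorr : ℕ → ℝ
  | 0 => 81 / 56
  | m + 1 => 25 / 56 * (20 / 81) ^ m

lemma levelCorr_succ (m k : ℕ) :
    levelCorr (m + 1) k = levelCorr m k - (5 / 9) ^ m * lagCorr ((m - k) + (k - m)) := by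
  rcases lt_trichotomy k m with h | rfl | h
  · obtain ⟨s, rfl⟩ := Nat.exists_eq_add_of_lt h
    rw [show k + s + 1 - k + (k - (k + s + 1)) = s + 1 by omega]
    rcases s with _ | s
    · have h1 : k + 0 + 1 + 1 - k - 2 = 0 := by omega
      simp [levelCorr, lagCorr, pow_succ, h1]; ring
    · have h1 : k + (s + 1) + 1 + 1 - k - 2 = s + 1 := by omega
      have h2 : k + (s + 1) + 1 - k - 2 = s := by omega
      have h3 : ¬ (k + 1 = k + (s + 1) + 1) := by omega
      have h4 : ¬ (k + 1 = k + (s + 1) + 1 + 1) := by omega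
      rw [levelCorr, levelCorr, if_pos (show k < k + (s + 1) + 1 + 1 by omega), if_neg h4,
        if_pos (show k < k + (s + 1) + 1 by omega), if_neg h3, h1, h2]
      simp only [lagCorr]
      ring
  · simp [levelCorr, lagCorr]
  · obtain ⟨s, rfl⟩ := Nat.exists_eq_add_of_lt h
    rw [show m - (m + s + 1) + (m + s + 1 - m) = s + 1 by omega]
    rcases s with _ | s
    · simp [levelCorr, lagCorr, pow_succ]; ring
    · have h1 : m + (s + 1) + 1 - (m + 1) - 1 = s := by omega
      have h2 : m + (s + 1) + 1 - m - 1 = s + 1 := by omega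
      rw [levelCorr, levelCorr, if_neg (by omega), if_neg (by omega), if_neg (by omega),
        if_neg (by omega), h1, h2]
      simp only [lagCorr]
      ring

lemma targetCorr_succ (m : ℕ) :
    targetCorr (m + 1) = targetCorr m - (5 / 9) ^ m * levelCorr 0 m := by
  rcases m with _ | m
  · norm_num [targetCorr, levelCorr]
  · simp only [targetCorr, levelCorr, Nat.not_lt_zero, if_false, Nat.succ_ne_zero,
      Nat.sub_zero, Nat.add_sub_cancel, pow_zero, mul_one]
    rw [show (20 / 81 : ℝ) = 5 / 9 * (4 / 9) by norm_num]
    simp only [mul_pow]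
    ring

lemma abs_levelCorr_le (m k : ℕ) : |levelCorr m k| ≤ (5 / 9) ^ m := by
  have h5 : (0 : ℝ) < (5 / 9) ^ m := by positivity
  have h4 : ∀ n, (4 / 9 : ℝ) ^ n ≤ 1 := fun n => pow_le_one₀ (by norm_num) (by norm_num)
  have h4' : ∀ n, (0 : ℝ) < (4 / 9 : ℝ) ^ n := fun n => by positivity
  unfold levelCorr
  split_ifs
  · simpa using h5.le
  · rw [abs_mul, abs_mul, abs_of_pos h5, abs_of_pos (h4' _)]
    norm_num
    nlinarith [h4 (m - k - 2)]
  · rw [abs_of_pos h5]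
  · rw [abs_mul, abs_mul, abs_of_pos h5, abs_of_pos (h4' _)]
    norm_num
    nlinarith [h4 (k - m - 1)]

/-- Off level `m`, the correlations with the dictionary are below the selected ones. -/
lemma abs_levelCorr_div_lt {m k : ℕ} (hk : k ≠ m) :
    (2 ^ k : ℝ)⁻¹ * |levelCorr m k| < (5 / 18) ^ m := by
  have h5 : (0 : ℝ) < (5 / 9) ^ m := by positivity
  have h4 : ∀ n, (4 / 9 : ℝ) ^ n ≤ 1 := fun n => pow_le_one₀ (by norm_num) (by norm_num)
  have h4' : ∀ n, (0 : ℝ) < (4 / 9 : ℝ) ^ n := fun n => by positivity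
  have h18 : (5 / 18 : ℝ) ^ m = (2 ^ m : ℝ)⁻¹ * (5 / 9) ^ m := by
    rw [show (5 / 18 : ℝ) = 2⁻¹ * (5 / 9) by norm_num, mul_pow, inv_pow]
  rcases lt_or_gt_of_ne hk with h | h
  · rw [levelCorr, if_pos h]
    split_ifs with h1
    · simp
    · obtain ⟨s, rfl⟩ : ∃ s, m = k + 2 + s := ⟨m - k - 2, by omega⟩
      rw [abs_mul, abs_mul, abs_of_pos h5, abs_of_pos (h4' _), h18,
        show k + 2 + s - k - 2 = s by omega, ← mul_assoc]
      refine mul_lt_mul_of_pos_right ?_ h5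
      have h8 : (8 / 9 : ℝ) ^ s ≤ 1 := pow_le_one₀ (by norm_num) (by norm_num)
      rw [show (4 / 9 : ℝ) = 2⁻¹ * (8 / 9) by norm_num, mul_pow, pow_add, pow_add, mul_inv,
        mul_inv, inv_pow]
      have hp : (0 : ℝ) < (2 ^ k)⁻¹ * (2 ^ s)⁻¹ := by positivity
      norm_num
      nlinarith
  · rw [levelCorr, if_neg (by omega), if_neg (by omega), abs_mul, abs_mul, abs_of_pos h5,
      abs_of_pos (h4' _), h18, ← mul_assoc]
    refine mul_lt_mul_of_pos_right ?_ h5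
    have h2 : (2 ^ k : ℝ)⁻¹ ≤ (2 ^ m)⁻¹ :=
      inv_anti₀ (by positivity) (pow_le_pow_right₀ (by norm_num) h.le)
    have hp : (0 : ℝ) < (2 ^ m)⁻¹ := by positivity
    have hp' : (0 : ℝ) < (2 ^ k)⁻¹ := by positivity
    norm_num
    nlinarith [h4 (k - m - 1)]

lemma abs_levelCorr_div_le (m k : ℕ) : (2 ^ k : ℝ)⁻¹ * |levelCorr m k| ≤ (5 / 18) ^ m := by
  rcases eq_or_ne k m with rfl | h
  · have : levelCorr k k = (5 / 9) ^ k := by simp [levelCorr]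
    rw [this, abs_of_pos (by positivity), show (5 / 18 : ℝ) = 2⁻¹ * (5 / 9) by norm_num, mul_pow,
      inv_pow]
  · exact (abs_levelCorr_div_lt h).le

lemma abs_targetCorr_le (m : ℕ) : |targetCorr m| ≤ 2 * (5 / 18) ^ m := by
  rcases m with _ | m
  · norm_num [targetCorr]
  · have h : (20 / 81 : ℝ) ^ m ≤ (5 / 18) ^ m :=
      pow_le_pow_left₀ (by norm_num) (by norm_num) m
    have h' : (0 : ℝ) < (5 / 18) ^ m := by positivity
    rw [targetCorr, abs_of_pos (by positivity), pow_succ]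
    nlinarith

lemma tendsto_levelCorr (k : ℕ) : Tendsto (fun m => levelCorr m k) atTop (𝓝 0) :=
  squeeze_zero_norm (fun m => abs_levelCorr_le m k)
    (tendsto_pow_atTop_nhds_zero_of_lt_one (by norm_num) (by norm_num))

lemma tendsto_targetCorr : Tendsto targetCorr atTop (𝓝 0) := by
  refine squeeze_zero_norm (fun m => abs_targetCorr_le m) ?_
  simpa using (tendsto_pow_atTop_nhds_zero_of_lt_one (r := (5 / 18 : ℝ)) (by norm_num)
    (by norm_num)).const_mul 2

namespace IsLevelSystem

variable {U : ℕ → H} {e : (Σ l : ℕ, Fin (4 ^ l)) → H} {v : H}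

lemma inner_U (h : IsLevelSystem U e v) (k l : ℕ) :
    inner ℝ (U k) (U l) = lagCorr ((k - l) + (l - k)) := by
  rcases le_total k l with hkl | hkl
  · obtain ⟨s, rfl⟩ := Nat.exists_eq_add_of_le hkl
    rw [h.inner_add]; congr 1; omega
  · obtain ⟨s, rfl⟩ := Nat.exists_eq_add_of_le hkl
    rw [real_inner_comm, h.inner_add]; congr 1; omega

lemma norm_U (h : IsLevelSystem U e v) (k : ℕ) : ‖U k‖ = 1 := by
  have := h.inner_add k 0
  rw [add_zero, real_inner_self_eq_norm_sq] at this
  simp only [lagCorr] at this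
  exact (pow_eq_one_iff_of_nonneg (norm_nonneg _) two_ne_zero).1 this

lemma inner_levelElement_of_forall {x : H} (hx : ∀ p, inner ℝ x (e p) = 0) (l : ℕ)
    (i : Fin (4 ^ l)) :
    inner ℝ x (levelElement U e l i) = (2 ^ l : ℝ)⁻¹ * inner ℝ x (U l) := by
  simp [levelElement, inner_add_right, inner_sub_right, inner_smul_right, inner_sum, hx]

lemma inner_levelElement_U (h : IsLevelSystem U e v) (l k : ℕ) (i : Fin (4 ^ l)) :
    inner ℝ (levelElement U e l i) (U k) = (2 ^ l : ℝ)⁻¹ * inner ℝ (U l) (U k) := by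
  rw [real_inner_comm, inner_levelElement_of_forall, real_inner_comm]
  intro p
  rw [real_inner_comm, h.inner_e_U]

lemma inner_levelElement_levelElement (h : IsLevelSystem U e v) {k l : ℕ} (hkl : k ≠ l)
    (i : Fin (4 ^ k)) (j : Fin (4 ^ l)) :
    inner ℝ (levelElement U e k i) (levelElement U e l j) =
      (2 ^ l : ℝ)⁻¹ * inner ℝ (levelElement U e k i) (U l) := by
  have hee : ∀ (i : Fin (4 ^ k)) (j : Fin (4 ^ l)),
      inner ℝ (e ⟨k, i⟩) (e ⟨l, j⟩) = (0 : ℝ) := fun i j => h.orthonormal.2 (by simp [hkl])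
  have hUe : ∀ p n, inner ℝ (U n) (e p) = (0 : ℝ) := fun p n => by
    rw [real_inner_comm, h.inner_e_U]
  simp [levelElement, inner_add_right, inner_sub_right, inner_smul_right, inner_sum,
    inner_add_left, inner_sub_left, inner_smul_left, sum_inner, hee, hUe, h.inner_e_U]

lemma inner_levelElement_self_level (h : IsLevelSystem U e v) (k : ℕ) (i j : Fin (4 ^ k)) :
    inner ℝ (levelElement U e k i) (levelElement U e k j) = if i = j then (1 : ℝ) else 0 := by
  have hee : ∀ (i j : Fin (4 ^ k)),
      inner ℝ (e ⟨k, i⟩) (e ⟨k, j⟩) = if i = j then (1 : ℝ) else 0 := fun i j => by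
    rw [orthonormal_iff_ite.1 h.orthonormal]; simp
  have hUe : ∀ p n, inner ℝ (U n) (e p) = (0 : ℝ) := fun p n => by
    rw [real_inner_comm, h.inner_e_U]
  have h4 : (4 ^ k : ℝ) = 2 ^ k * 2 ^ k := by rw [← mul_pow]; norm_num
  simp [levelElement, inner_add_right, inner_sub_right, inner_smul_right, inner_sum,
    inner_add_left, inner_sub_left, inner_smul_left, sum_inner, hee, hUe, h.inner_e_U, h.norm_U, h4]
  field_simp
  ring

lemma sum_levelElement (l : ℕ) : ∑ i, levelElement U e l i = (2 ^ l : ℝ) • U l := by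
  have h4 : (4 ^ l : ℝ) = 2 ^ l * 2 ^ l := by rw [← mul_pow]; norm_num
  simp only [levelElement, Finset.sum_add_distrib, Finset.sum_sub_distrib, Finset.sum_const,
    Finset.card_univ, Fintype.card_fin, ← Nat.cast_smul_eq_nsmul ℝ, smul_smul]
  push_cast
  rw [mul_inv_cancel₀ (by positivity), one_smul, sub_self, zero_add, h4]
  congr 1
  field_simp

lemma hasSum_target [CompleteSpace H] (h : IsLevelSystem U e v) :
    HasSum (fun l => (5 / 9 : ℝ) ^ l • U l) (target U) := by
  refine Summable.hasSum (Summable.of_norm ?_)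
  simpa [norm_smul, h.norm_U] using
    summable_geometric_of_lt_one (r := (5 / 9 : ℝ)) (by norm_num) (by norm_num)

lemma tendsto_partialTarget [CompleteSpace H] (h : IsLevelSystem U e v) :
    Tendsto (partialTarget U) atTop (𝓝 (target U)) := h.hasSum_target.tendsto_sum_nat

lemma inner_partialTarget_U (h : IsLevelSystem U e v) (m k : ℕ) :
    inner ℝ (partialTarget U m) (U k) = levelCorr 0 k - levelCorr m k := by
  induction m with
  | zero => simp [partialTarget]
  | succ m ih =>
    rw [partialTarget, Finset.sum_range_succ, inner_add_left, ← partialTarget, ih, inner_smul_left,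
      h.inner_U, levelCorr_succ]
    simp
    ring

lemma inner_partialTarget_e (h : IsLevelSystem U e v) (m : ℕ) (p) :
    inner ℝ (partialTarget U m) (e p) = 0 := by
  rw [real_inner_comm]
  simp [partialTarget, inner_sum, inner_smul_right, h.inner_e_U p]

lemma inner_residual_of_forall {x : H} {α β : ℝ} {m : ℕ} (S : Finset (Fin (4 ^ m)))
    (hx : ∀ i, inner ℝ (levelElement U e m i) x = (2 ^ m : ℝ)⁻¹ * inner ℝ (U m) x)
    (hα : inner ℝ (target U - partialTarget U m) x = α)
    (hβ : inner ℝ (target U - partialTarget U (m + 1)) x = β) :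
    inner ℝ (target U - stateApprox U e m S) x =
      (1 - S.card / 4 ^ m) * α + S.card / 4 ^ m * β := by
  have h4 : (4 ^ m : ℝ) = 2 ^ m * 2 ^ m := by rw [← mul_pow]; norm_num
  have h18 : (5 / 18 : ℝ) ^ m = (2 ^ m : ℝ)⁻¹ * (5 / 9) ^ m := by
    rw [show (5 / 18 : ℝ) = 2⁻¹ * (5 / 9) by norm_num, mul_pow, inv_pow]
  have hab : (5 / 9) ^ m * inner ℝ (U m) x = α - β := by
    rw [← hα, ← hβ, partialTarget, partialTarget, Finset.sum_range_succ]
    simp [inner_sub_left, inner_add_left, inner_smul_left]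
  rw [stateApprox, ← sub_sub, inner_sub_left, hα, inner_smul_left, sum_inner]
  simp only [hx, Finset.sum_const, nsmul_eq_mul, RCLike.conj_to_real]
  rw [h18, h4]
  field_simp
  linear_combination (-(S.card : ℝ)) * hab

variable [CompleteSpace H]

lemma inner_target_U (h : IsLevelSystem U e v) (k : ℕ) :
    inner ℝ (target U) (U k) = levelCorr 0 k := by
  refine tendsto_nhds_unique (h.tendsto_partialTarget.inner tendsto_const_nhds) ?_
  simp only [h.inner_partialTarget_U]
  simpa using (tendsto_levelCorr k).const_sub (levelCorr 0 k)

lemma inner_target_eq_zero (h : IsLevelSystem U e v) {x : H} (hx : ∀ n, inner ℝ x (U n) = 0) :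
    inner ℝ x (target U) = 0 := by
  refine tendsto_nhds_unique (tendsto_const_nhds.inner h.tendsto_partialTarget) ?_
  simp [partialTarget, inner_sum, inner_smul_right, hx]

lemma inner_partialTarget_target (h : IsLevelSystem U e v) (m : ℕ) :
    inner ℝ (partialTarget U m) (target U) = 81 / 56 - targetCorr m := by
  induction m with
  | zero => simp [partialTarget, targetCorr]
  | succ m ih =>
    rw [partialTarget, Finset.sum_range_succ, inner_add_left, ← partialTarget, ih, inner_smul_left,
      real_inner_comm, h.inner_target_U, targetCorr_succ]
    simp
    ring

lemma inner_target_self (h : IsLevelSystem U e v) :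
    inner ℝ (target U) (target U) = (81 / 56 : ℝ) := by
  refine tendsto_nhds_unique (h.tendsto_partialTarget.inner tendsto_const_nhds) ?_
  simp only [h.inner_partialTarget_target]
  simpa using tendsto_targetCorr.const_sub (81 / 56)

lemma inner_residual_U (h : IsLevelSystem U e v) (m k : ℕ) (S : Finset (Fin (4 ^ m))) :
    inner ℝ (target U - stateApprox U e m S) (U k) =
      (1 - S.card / 4 ^ m) * levelCorr m k + S.card / 4 ^ m * levelCorr (m + 1) k := by
  refine inner_residual_of_forall S (fun i => h.inner_levelElement_U _ _ _) ?_ ?_ <;>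
    rw [inner_sub_left, h.inner_target_U, h.inner_partialTarget_U] <;> ring

lemma inner_residual_target (h : IsLevelSystem U e v) (m : ℕ) (S : Finset (Fin (4 ^ m))) :
    inner ℝ (target U - stateApprox U e m S) (target U) =
      (1 - S.card / 4 ^ m) * targetCorr m + S.card / 4 ^ m * targetCorr (m + 1) := by
  refine inner_residual_of_forall S (fun i => ?_) ?_ ?_
  · rw [real_inner_comm, inner_levelElement_of_forall, real_inner_comm]
    intro p
    rw [real_inner_comm]
    exact h.inner_target_eq_zero (h.inner_e_U p)
  all_goals
    rw [inner_sub_left, h.inner_target_self, h.inner_partialTarget_target]; ring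

lemma inner_target_e (h : IsLevelSystem U e v) (p) : inner ℝ (target U) (e p) = 0 := by
  rw [real_inner_comm]
  exact h.inner_target_eq_zero (h.inner_e_U p)

lemma inner_residual_levelElement_of_ne (h : IsLevelSystem U e v) {m k : ℕ} (hk : k ≠ m)
    (S : Finset (Fin (4 ^ m))) (i : Fin (4 ^ k)) :
    inner ℝ (target U - stateApprox U e m S) (levelElement U e k i) =
      (2 ^ k : ℝ)⁻¹ * inner ℝ (target U - stateApprox U e m S) (U k) := by
  simp only [stateApprox, inner_sub_left, inner_add_left, inner_smul_left, sum_inner,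
    inner_levelElement_of_forall h.inner_target_e, RCLike.conj_to_real,
    inner_levelElement_of_forall (h.inner_partialTarget_e m),
    h.inner_levelElement_levelElement hk.symm, ← Finset.mul_sum]
  ring

lemma inner_residual_levelElement_level (h : IsLevelSystem U e v) (m : ℕ)
    (S : Finset (Fin (4 ^ m))) (i : Fin (4 ^ m)) :
    inner ℝ (target U - stateApprox U e m S) (levelElement U e m i) =
      if i ∈ S then 0 else (5 / 18 : ℝ) ^ m := by
  have h18 : (5 / 18 : ℝ) ^ m = (2 ^ m : ℝ)⁻¹ * (5 / 9) ^ m := by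
    rw [show (5 / 18 : ℝ) = 2⁻¹ * (5 / 9) by norm_num, mul_pow, inv_pow]
  have hm : levelCorr m m = (5 / 9) ^ m := by simp [levelCorr]
  simp only [stateApprox, inner_sub_left, inner_add_left, inner_smul_left, sum_inner,
    inner_levelElement_of_forall h.inner_target_e, RCLike.conj_to_real,
    inner_levelElement_of_forall (h.inner_partialTarget_e m), h.inner_levelElement_self_level,
    h.inner_target_U, h.inner_partialTarget_U, Finset.sum_ite_eq', hm]
  split_ifs <;> rw [h18] <;> ring

lemma inner_residual_v (h : IsLevelSystem U e v) (m : ℕ) (S : Finset (Fin (4 ^ m))) :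
    inner ℝ (target U - stateApprox U e m S) v = 0 := by
  rw [real_inner_comm]
  simp [stateApprox, partialTarget, inner_sub_right, inner_add_right, inner_smul_right, inner_sum,
    inner_levelElement_of_forall h.inner_v_e, h.inner_v_U, h.inner_target_eq_zero h.inner_v_U]

end IsLevelSystem

end LevelSystem

section Dictionary

open Filter Topology

variable {H : Type*} [NormedAddCommGroup H] [InnerProductSpace ℝ H]

/-- The two elements whose sum is a multiple of the target vector. -/
noncomputable def poleElement (U : ℕ → H) (v : H) (s : ℝ) (b : Bool) : H :=
  (1 / 4 : ℝ) • target U + (if b then s else -s) • v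

/-- The part of the dictionary that the algorithm sees. -/
def coreDictionary (U : ℕ → H) (e : (Σ l : ℕ, Fin (4 ^ l)) → H) (v : H) (s : ℝ) : Set H :=
  Set.range (fun p : Σ l : ℕ, Fin (4 ^ l) => levelElement U e p.1 p.2) ∪
    Set.range (poleElement U v s)

lemma abs_lagCorr_le (d : ℕ) : |lagCorr d| ≤ (4 / 9) ^ d := by
  match d with
  | 0 => simp [lagCorr]
  | 1 => norm_num [lagCorr, abs_of_pos]
  | d + 2 =>
    have h : (0 : ℝ) < (4 / 9) ^ d := by positivity
    rw [lagCorr, abs_mul, abs_of_pos h, pow_add]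
    norm_num
    nlinarith

lemma ENNReal.tsum_pow_dist_le (r : ℝ≥0∞) (k : ℕ) :
    ∑' l : ℕ, r ^ ((k - l) + (l - k)) ≤ 2 * ∑' n : ℕ, r ^ n := by
  calc ∑' l : ℕ, r ^ ((k - l) + (l - k))
      ≤ ∑' l : ℕ, ∑' n : ℕ, ((if l = k + n then r ^ n else 0) +
          if k = l + n then r ^ n else 0) := by
        refine ENNReal.tsum_le_tsum fun l => ?_
        refine le_trans ?_ (ENNReal.le_tsum ((k - l) + (l - k)))
        rcases le_total l k with h | h
        · rw [if_pos (show k = l + ((k - l) + (l - k)) by omega)]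
          exact le_add_self
        · rw [if_pos (show l = k + ((k - l) + (l - k)) by omega)]
          exact le_self_add
    _ = ∑' n : ℕ, ∑' l : ℕ, ((if l = k + n then r ^ n else 0) +
          if k = l + n then r ^ n else 0) := ENNReal.tsum_comm
    _ ≤ ∑' n : ℕ, 2 * r ^ n := by
        refine ENNReal.tsum_le_tsum fun n => ?_
        rw [ENNReal.tsum_add, tsum_ite_eq, two_mul]
        gcongr
        rcases le_or_gt n k with h | h
        · have : ∀ l, (if k = l + n then r ^ n else 0) = if l = k - n then r ^ n else 0 :=
            fun l => by congr 1; simp only [eq_iff_iff]; omega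
          simp only [this, tsum_ite_eq, le_refl]
        · have : ∀ l, (if k = l + n then r ^ n else 0) = 0 := fun l => if_neg (by omega)
          simp [this]
    _ = 2 * ∑' n : ℕ, r ^ n := ENNReal.tsum_mul_left

lemma ENNReal.tsum_range_le {α β : Type*} (φ : α → β) (f : β → ℝ≥0∞) :
    ∑' x : Set.range φ, f x ≤ ∑' a, f (φ a) :=
  ENNReal.tsum_le_tsum_comp_of_surjective Set.rangeFactorization_surjective
    (fun x : Set.range φ => f x)

/-- Adding an orthonormal set orthogonal to `A` does not increase the coherence sums. -/
lemma cumulativeCoherence_union_le {A B : Set H} {K : ℝ≥0∞}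
    (hA : ∀ g ∈ A, ∑' x : A, ENNReal.ofReal |inner ℝ (x : H) g| ≤ K)
    (hB : ∀ g ∈ B, ∀ x ∈ A ∪ B, x ≠ g → inner ℝ x g = 0) :
    cumulativeCoherence (A ∪ B) ≤ K := by
  refine iSup₂_le fun g hg => ?_
  by_cases hgB : g ∈ B
  · refine le_of_eq_of_le (ENNReal.tsum_eq_zero.2 ?_) zero_le
    rintro ⟨x, hx, hxg⟩
    simp [hB g hgB x hx hxg]
  · have hgA : g ∈ A := hg.resolve_right hgB
    refine le_trans ?_ (hA g hgA)
    refine le_of_eq_of_le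
      (tsum_subtype {x : H | x ∈ A ∪ B ∧ x ≠ g} (fun x => ENNReal.ofReal |inner ℝ x g|)) ?_
    rw [tsum_subtype A (fun x => ENNReal.ofReal |inner ℝ x g|)]
    refine ENNReal.tsum_le_tsum fun x => Set.indicator_apply_le fun hx => ?_
    by_cases hxA : x ∈ A
    · rw [Set.indicator_of_mem hxA]
    · have := hB x (hx.1.resolve_left hxA) g hg hx.2.symm
      rw [real_inner_comm] at this
      simp [this]

/-- Every set is completed to one with dense span by unit vectors orthogonal to it and to one
another. -/
lemma exists_orthogonal_completion [CompleteSpace H] (A : Set H) :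
    ∃ B : Set H, (∀ x ∈ B, ‖x‖ = 1) ∧ (∀ g ∈ B, ∀ x ∈ A ∪ B, x ≠ g → inner ℝ x g = 0) ∧
      (∀ g ∈ B, ∀ x ∈ A, inner ℝ x g = 0) ∧
      (Submodule.span ℝ (A ∪ B)).topologicalClosure = ⊤ := by
  obtain ⟨w, b, hb⟩ := exists_hilbertBasis ℝ (Submodule.span ℝ A)ᗮ
  have hAw : ∀ g ∈ Subtype.val '' w, ∀ x ∈ A, inner ℝ x g = 0 := by
    rintro _ ⟨g, _, rfl⟩ x hx
    exact (Submodule.mem_orthogonal _ _).1 g.2 x (Submodule.subset_span hx)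
  have hbw : ∀ i : w, b i = i := fun i => by rw [hb]
  refine ⟨Subtype.val '' w, ?_, ?_, hAw, ?_⟩
  · rintro _ ⟨g, hg, rfl⟩
    have := b.orthonormal.1 ⟨g, hg⟩
    rwa [hbw] at this
  · rintro _ ⟨g, hg, rfl⟩ x (hx | ⟨y, hy, rfl⟩) hne
    · exact hAw _ ⟨g, hg, rfl⟩ x hx
    · have hne' : (⟨y, hy⟩ : w) ≠ ⟨g, hg⟩ := fun h =>
        hne (congrArg Subtype.val (congrArg Subtype.val h))
      have : inner ℝ (b ⟨y, hy⟩) (b ⟨g, hg⟩) = (0 : ℝ) := b.orthonormal.2 hne'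
      rw [hbw, hbw] at this
      exact this
  · rw [Submodule.topologicalClosure_eq_top_iff, Submodule.eq_bot_iff]
    intro x hx
    have hx' := (Submodule.mem_orthogonal _ _).1 hx
    have hxA : x ∈ (Submodule.span ℝ A)ᗮ := (Submodule.mem_orthogonal _ _).2 fun u hu =>
      hx' u (Submodule.span_mono Set.subset_union_left hu)
    have h0 : b.repr ⟨x, hxA⟩ = 0 := by
      ext i
      rw [b.repr_apply_apply, hbw]
      exact hx' _ (Submodule.subset_span (Or.inr ⟨i, i.2, rfl⟩))
    simpa [Subtype.ext_iff] using h0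

namespace IsLevelSystem

variable {U : ℕ → H} {e : (Σ l : ℕ, Fin (4 ^ l)) → H} {v : H} {s : ℝ}

lemma norm_levelElement (h : IsLevelSystem U e v) (l : ℕ) (i : Fin (4 ^ l)) :
    ‖levelElement U e l i‖ = 1 := by
  have := h.inner_levelElement_self_level l i i
  rw [if_pos rfl, real_inner_self_eq_norm_sq] at this
  exact (pow_eq_one_iff_of_nonneg (norm_nonneg _) two_ne_zero).1 this

lemma abs_inner_levelElement_le (h : IsLevelSystem U e v) {k l : ℕ} (hkl : l ≠ k)
    (i : Fin (4 ^ k)) (j : Fin (4 ^ l)) :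
    4 ^ l * |inner ℝ (levelElement U e l j) (levelElement U e k i)| ≤
      (8 / 9) ^ ((k - l) + (l - k)) := by
  rw [h.inner_levelElement_levelElement hkl, h.inner_levelElement_U, h.inner_U, abs_mul, abs_mul,
    abs_of_pos (by positivity), abs_of_pos (by positivity),
    show (l - k) + (k - l) = (k - l) + (l - k) by omega]
  have h4 : (4 ^ l : ℝ) = 2 ^ l * 2 ^ l := by rw [← mul_pow]; norm_num
  have hlag := abs_lagCorr_le ((k - l) + (l - k))
  have h2 : (2 ^ l : ℝ) ≤ 2 ^ k * 2 ^ ((k - l) + (l - k)) := by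
    rw [← pow_add]
    exact pow_le_pow_right₀ (by norm_num) (by omega)
  rw [show (8 / 9 : ℝ) = 2 * (4 / 9) by norm_num, mul_pow, h4]
  set d := (k - l) + (l - k)
  have hk : (0 : ℝ) < 2 ^ k := by positivity
  calc (2 ^ l * 2 ^ l : ℝ) * ((2 ^ k)⁻¹ * ((2 ^ l)⁻¹ * |lagCorr d|))
      = 2 ^ l * (2 ^ k)⁻¹ * |lagCorr d| := by field_simp
    _ ≤ 2 ^ d * (4 / 9) ^ d := by
      refine mul_le_mul ?_ hlag (abs_nonneg _) (by positivity)
      rw [← div_eq_mul_inv, div_le_iff₀ hk]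
      linarith

lemma levelCorr_zero_le (l : ℕ) : 2 ^ l * |levelCorr 0 l| ≤ 4 * (8 / 9) ^ l := by
  rw [show (8 / 9 : ℝ) = 2 * (4 / 9) by norm_num, mul_pow]
  rcases l with _ | l
  · norm_num [levelCorr]
  · simp only [levelCorr, Nat.not_lt_zero, if_false, Nat.succ_ne_zero, Nat.sub_zero,
      Nat.add_sub_cancel, pow_zero, mul_one]
    rw [abs_of_pos (by positivity), pow_succ (4 / 9 : ℝ)]
    have : (0 : ℝ) < 2 ^ (l + 1) * (4 / 9) ^ l := by positivity
    nlinarith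

lemma coherence_bound_lt_top : 2 * ∑' n : ℕ, ENNReal.ofReal (8 / 9) ^ n + 2 < ⊤ := by
  rw [ENNReal.tsum_geometric]
  refine ENNReal.add_lt_top.2 ⟨ENNReal.mul_lt_top (by simp) ?_, by simp⟩
  rw [ENNReal.inv_lt_top, tsub_pos_iff_lt]
  exact ENNReal.ofReal_lt_one.2 (by norm_num)

lemma target_eq (s : ℝ) :
    target U = (2 : ℝ) • (poleElement U v s true + poleElement U v s false) := by
  simp only [poleElement, if_true, Bool.false_eq_true, if_false]
  module

lemma target_mem_span (U : ℕ → H) (e : (Σ l : ℕ, Fin (4 ^ l)) → H) (v : H) (s : ℝ) :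
    target U ∈ Submodule.span ℝ (coreDictionary U e v s) := by
  rw [target_eq (v := v) s]
  exact Submodule.smul_mem _ _ (Submodule.add_mem _
    (Submodule.subset_span (Or.inr ⟨_, rfl⟩)) (Submodule.subset_span (Or.inr ⟨_, rfl⟩)))

lemma stateApprox_mem_span (U : ℕ → H) (e : (Σ l : ℕ, Fin (4 ^ l)) → H) (v : H) (s : ℝ) (m : ℕ)
    (S : Finset (Fin (4 ^ m))) :
    stateApprox U e m S ∈ Submodule.span ℝ (coreDictionary U e v s) := by
  have hg : ∀ l i, levelElement U e l i ∈ Submodule.span ℝ (coreDictionary U e v s) := fun l i =>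
    Submodule.subset_span (Or.inl ⟨⟨l, i⟩, rfl⟩)
  have hU : ∀ l, U l ∈ Submodule.span ℝ (coreDictionary U e v s) := fun l => by
    have h2 : (2 ^ l : ℝ) ≠ 0 := by positivity
    rw [← Submodule.smul_mem_iff _ h2, ← sum_levelElement (e := e)]
    exact Submodule.sum_mem _ fun i _ => hg l i
  exact Submodule.add_mem _ (Submodule.sum_mem _ fun l _ => Submodule.smul_mem _ _ (hU l))
    (Submodule.smul_mem _ _ (Submodule.sum_mem _ fun i _ => hg m i))

variable [CompleteSpace H]

lemma norm_poleElement (h : IsLevelSystem U e v) (hs : s ^ 2 = 815 / 896) (b : Bool) :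
    ‖poleElement U v s b‖ = 1 := by
  refine (pow_eq_one_iff_of_nonneg (norm_nonneg _) two_ne_zero).1 ?_
  have h0 := h.inner_target_eq_zero h.inner_v_U
  have h1 := h0
  rw [real_inner_comm] at h1
  have hv : inner ℝ v v = (1 : ℝ) := by simp [h.norm_v]
  rw [← real_inner_self_eq_norm_sq, poleElement]
  simp only [inner_add_left, inner_add_right, inner_smul_left, inner_smul_right, h0, h1, hv,
    h.inner_target_self, RCLike.conj_to_real]
  cases b <;> simp <;> linear_combination hs

lemma norm_eq_one_of_mem_coreDictionary (h : IsLevelSystem U e v) (hs : s ^ 2 = 815 / 896)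
    {x : H} (hx : x ∈ coreDictionary U e v s) : ‖x‖ = 1 := by
  obtain ⟨p, rfl⟩ | ⟨b, rfl⟩ := hx
  · exact h.norm_levelElement _ _
  · exact h.norm_poleElement hs b

lemma tsum_levelElement_le (h : IsLevelSystem U e v) {g : H} (hg : g ∈ coreDictionary U e v s) :
    ∑' p : Σ l : ℕ, Fin (4 ^ l), ENNReal.ofReal |inner ℝ (levelElement U e p.1 p.2) g| ≤
      2 * ∑' n : ℕ, ENNReal.ofReal (8 / 9) ^ n := by
  rw [ENNReal.tsum_sigma' (fun p : Σ l : ℕ, Fin (4 ^ l) =>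
    ENNReal.ofReal |inner ℝ (levelElement U e p.1 p.2) g|)]
  simp only [tsum_fintype]
  have bound : ∀ (l : ℕ) (c d : ℝ), (∀ j : Fin (4 ^ l), |inner ℝ (levelElement U e l j) g| = c) →
      4 ^ l * c ≤ d →
      ∑ j, ENNReal.ofReal |inner ℝ (levelElement U e l j) g| ≤ ENNReal.ofReal d := by
    intro l c d hc hd
    simp only [hc, Finset.sum_const, Finset.card_univ, Fintype.card_fin, nsmul_eq_mul]
    refine le_trans (le_of_eq ?_) (ENNReal.ofReal_le_ofReal hd)
    rw [ENNReal.ofReal_mul (by positivity)]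
    congr 1
    rw [ENNReal.ofReal_pow (by norm_num)]
    norm_num
  obtain ⟨⟨k, i⟩, rfl⟩ | ⟨b, rfl⟩ := hg
  · refine le_trans (ENNReal.tsum_le_tsum fun l => ?_) (ENNReal.tsum_pow_dist_le _ k)
    rw [← ENNReal.ofReal_pow (by norm_num)]
    by_cases hl : l = k
    · subst hl
      rw [Finset.sum_eq_single i]
      · simp [h.norm_levelElement]
      · intro j _ hj
        simp [h.inner_levelElement_self_level, hj]
      · simp
    · have j₀ : Fin (4 ^ l) := ⟨0, by positivity⟩
      refine bound l |inner ℝ (levelElement U e l j₀) (levelElement U e k i)| _ (fun j => ?_)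
        (h.abs_inner_levelElement_le hl i j₀)
      simp only [h.inner_levelElement_levelElement hl, h.inner_levelElement_U]
  · refine le_trans (ENNReal.tsum_le_tsum fun l => ?_) (le_mul_of_one_le_left' one_le_two)
    rw [← ENNReal.ofReal_pow (by norm_num)]
    refine bound l (1 / 4 * ((2 ^ l : ℝ)⁻¹ * |levelCorr 0 l|)) _ (fun j => ?_) ?_
    · rw [poleElement, inner_add_right, inner_smul_right, inner_smul_right,
        real_inner_comm v, real_inner_comm (target U),
        inner_levelElement_of_forall h.inner_v_e, inner_levelElement_of_forall h.inner_target_e,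
        h.inner_v_U, h.inner_target_U, mul_zero, mul_zero, add_zero, abs_mul, abs_mul,
        abs_of_pos (by norm_num : (0 : ℝ) < 1 / 4),
        abs_of_pos (by positivity : (0 : ℝ) < (2 ^ l)⁻¹)]
    · have h4 : (4 ^ l : ℝ) = 2 ^ l * 2 ^ l := by rw [← mul_pow]; norm_num
      have := levelCorr_zero_le l
      have h' : (4 ^ l : ℝ) * (1 / 4 * ((2 ^ l : ℝ)⁻¹ * |levelCorr 0 l|)) =
          1 / 4 * (2 ^ l * |levelCorr 0 l|) := by rw [h4]; field_simp
      rw [h']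
      linarith

lemma tsum_coreDictionary_le (h : IsLevelSystem U e v) (hs : s ^ 2 = 815 / 896) {g : H}
    (hg : g ∈ coreDictionary U e v s) :
    ∑' x : coreDictionary U e v s, ENNReal.ofReal |inner ℝ (x : H) g| ≤
      2 * ∑' n : ℕ, ENNReal.ofReal (8 / 9) ^ n + 2 := by
  refine (ENNReal.tsum_union_le (fun x => ENNReal.ofReal |inner ℝ x g|) _ _).trans ?_
  gcongr
  · exact (ENNReal.tsum_range_le _ (fun x => ENNReal.ofReal |inner ℝ x g|)).trans (h.tsum_levelElement_le hg)
  · refine (ENNReal.tsum_range_le _ (fun x => ENNReal.ofReal |inner ℝ x g|)).trans ?_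
    have hle : ∀ b, ENNReal.ofReal |inner ℝ (poleElement U v s b) g| ≤ 1 := fun b => by
      have := abs_real_inner_le_norm (poleElement U v s b) g
      rw [h.norm_poleElement hs, h.norm_eq_one_of_mem_coreDictionary hs hg, one_mul] at this
      exact ENNReal.ofReal_le_one.2 this
    rw [tsum_fintype, Fintype.sum_bool, ← one_add_one_eq_two]
    exact add_le_add (hle _) (hle _)

end IsLevelSystem

end Dictionary

section Dynamics

open Filter Topology

variable {H : Type*} [NormedAddCommGroup H] [InnerProductSpace ℝ H]

lemma abs_convex_lt {t a b r : ℝ} (ht0 : 0 ≤ t) (ht1 : t < 1) (ha : |a| < r) (hb : |b| ≤ r) :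
    |(1 - t) * a + t * b| < r := by
  rw [abs_lt] at *
  rw [abs_le] at hb
  constructor <;> nlinarith

lemma card_div_mem_Ico {m : ℕ} {S : Finset (Fin (4 ^ m))} (hS : S ≠ Finset.univ) :
    (0 : ℝ) ≤ S.card / 4 ^ m ∧ (S.card / 4 ^ m : ℝ) < 1 := by
  refine ⟨by positivity, (div_lt_one (by positivity)).2 ?_⟩
  have := (Finset.card_lt_iff_ne_univ S).2 hS
  rw [Fintype.card_fin] at this
  exact_mod_cast this

/-- Having selected one more element of level `m`, one passes to another state. -/
lemma exists_next_state (U : ℕ → H) (e : (Σ l : ℕ, Fin (4 ^ l)) → H) {m : ℕ}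
    {S : Finset (Fin (4 ^ m))} {i : Fin (4 ^ m)} (hi : i ∉ S) :
    ∃ (m' : ℕ) (S' : Finset (Fin (4 ^ m'))), S' ≠ Finset.univ ∧
      ∑ l ∈ Finset.range m', 4 ^ l + S'.card = ∑ l ∈ Finset.range m, 4 ^ l + S.card + 1 ∧
      stateApprox U e m' S' = stateApprox U e m S + (5 / 18 : ℝ) ^ m • levelElement U e m i := by
  have hstep : stateApprox U e m (insert i S) =
      stateApprox U e m S + (5 / 18 : ℝ) ^ m • levelElement U e m i := by
    rw [stateApprox, stateApprox, Finset.sum_insert hi, smul_add]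
    abel
  by_cases hS : insert i S = Finset.univ
  · refine ⟨m + 1, ∅, ?_, ?_, ?_⟩
    · refine (Finset.univ_nonempty_iff.2 ⟨⟨0, by positivity⟩⟩).ne_empty.symm
    · have := Finset.card_insert_of_notMem hi
      rw [hS, Finset.card_univ, Fintype.card_fin] at this
      rw [Finset.sum_range_succ, Finset.card_empty]
      omega
    · rw [← hstep, hS, stateApprox, stateApprox, IsLevelSystem.sum_levelElement, smul_smul,
        ← mul_pow, partialTarget, partialTarget, Finset.sum_range_succ]
      norm_num
  · exact ⟨m, insert i S, hS, by rw [Finset.card_insert_of_notMem hi]; ring, hstep⟩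

namespace IsLevelSystem

variable [CompleteSpace H] {U : ℕ → H} {e : (Σ l : ℕ, Fin (4 ^ l)) → H} {v : H} {s : ℝ}
  {m : ℕ} {S : Finset (Fin (4 ^ m))}

lemma eq_levelElement_or_abs_inner_lt (h : IsLevelSystem U e v) (hS : S ≠ Finset.univ) {x : H}
    (hx : x ∈ coreDictionary U e v s) :
    (∃ i ∉ S, x = levelElement U e m i) ∨
      |inner ℝ (target U - stateApprox U e m S) x| < (5 / 18) ^ m := by
  obtain ⟨ht0, ht1⟩ := card_div_mem_Ico hS
  have h18 : (5 / 18 : ℝ) ^ (m + 1) ≤ (5 / 18) ^ m :=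
    pow_le_pow_of_le_one (by norm_num) (by norm_num) (Nat.le_succ m)
  have hpos : (0 : ℝ) < (5 / 18) ^ m := by positivity
  obtain ⟨⟨k, i⟩, rfl⟩ | ⟨b, rfl⟩ := hx
  · by_cases hk : k = m
    · subst hk
      by_cases hi : i ∈ S
      · right
        rw [h.inner_residual_levelElement_level, if_pos hi, abs_zero]
        exact hpos
      · exact Or.inl ⟨i, hi, rfl⟩
    · right
      have h2 : (0 : ℝ) < (2 ^ k)⁻¹ := by positivity
      rw [h.inner_residual_levelElement_of_ne hk, h.inner_residual_U, mul_add, mul_left_comm,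
        mul_left_comm _ (S.card / 4 ^ m : ℝ)]
      refine abs_convex_lt ht0 ht1 ?_ ?_
      · rw [abs_mul, abs_of_pos h2]
        exact abs_levelCorr_div_lt hk
      · rw [abs_mul, abs_of_pos h2]
        exact (abs_levelCorr_div_le _ _).trans h18
  · right
    rw [poleElement, inner_add_right, inner_smul_right, inner_smul_right, h.inner_residual_v,
      mul_zero, add_zero, h.inner_residual_target, mul_add, mul_left_comm,
        mul_left_comm _ (S.card / 4 ^ m : ℝ)]
    have hq := abs_targetCorr_le m
    have hq' := abs_targetCorr_le (m + 1)
    refine abs_convex_lt ht0 ht1 ?_ ?_ <;>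
    · rw [abs_mul, abs_of_pos (by norm_num : (0 : ℝ) < 1 / 4)]
      linarith

lemma le_norm_residual (h : IsLevelSystem U e v) (hS : S ≠ Finset.univ) :
    (5 / 9 : ℝ) ^ (m + 1) ≤ ‖target U - stateApprox U e m S‖ := by
  obtain ⟨ht0, ht1⟩ := card_div_mem_Ico hS
  have h1 := real_inner_le_norm (target U - stateApprox U e m S) (U (m + 1))
  rw [h.norm_U, mul_one, h.inner_residual_U] at h1
  refine le_trans ?_ h1
  have ha : levelCorr m (m + 1) = 305 / 504 * (5 / 9) ^ m := by simp [levelCorr]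
  have hb : levelCorr (m + 1) (m + 1) = (5 / 9) ^ (m + 1) := by simp [levelCorr]
  have hp : (0 : ℝ) < (5 / 9) ^ m := by positivity
  rw [ha, hb, pow_succ]
  nlinarith [mul_nonneg (sub_nonneg.2 ht1.le) hp.le]

variable {D : Set H}

lemma exists_selection (h : IsLevelSystem U e v) (hgD : ∀ l i, levelElement U e l i ∈ D)
    (hD : ∀ (m : ℕ) (S : Finset (Fin (4 ^ m))), S ≠ Finset.univ → ∀ x ∈ D,
      (∃ i ∉ S, x = levelElement U e m i) ∨
        |inner ℝ (target U - stateApprox U e m S) x| < (5 / 18) ^ m) :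
    ∃ g : ℕ → H, IsPGASelection D (target U) g := by
  let State := {p : Σ m : ℕ, Finset (Fin (4 ^ m)) // p.2 ≠ Finset.univ}
  have step : ∀ σ : State, ∃ (x : H) (τ : State), x ∈ D ∧
      (∀ y ∈ D, |inner ℝ (target U - stateApprox U e σ.1.1 σ.1.2) y| ≤
        |inner ℝ (target U - stateApprox U e σ.1.1 σ.1.2) x|) ∧
      stateApprox U e τ.1.1 τ.1.2 = stateApprox U e σ.1.1 σ.1.2 +
        (inner ℝ (target U - stateApprox U e σ.1.1 σ.1.2) x : ℝ) • x := by
    rintro ⟨⟨m, S⟩, hS⟩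
    obtain ⟨i, hi⟩ := not_forall.1 (mt Finset.eq_univ_iff_forall.2 hS)
    obtain ⟨m', S', hS', -, happ⟩ := exists_next_state U e hi
    have hin : ∀ j ∉ S, inner ℝ (target U - stateApprox U e m S) (levelElement U e m j) =
        (5 / 18 : ℝ) ^ m := fun j hj => by
      rw [h.inner_residual_levelElement_level, if_neg hj]
    refine ⟨levelElement U e m i, ⟨⟨m', S'⟩, hS'⟩, hgD m i, fun y hy => ?_, ?_⟩
    · dsimp only
      rw [hin i hi, abs_of_pos (by positivity : (0 : ℝ) < (5 / 18) ^ m)]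
      obtain ⟨j, hj, rfl⟩ | hlt := hD m S hS y hy
      · rw [hin j hj, abs_of_pos (by positivity)]
      · exact hlt.le
    · dsimp only
      rw [happ, hin i hi]
  choose x next hxD hmax happ using step
  have h0 : (∅ : Finset (Fin (4 ^ 0))) ≠ Finset.univ :=
    (Finset.univ_nonempty_iff.2 ⟨⟨0, by positivity⟩⟩).ne_empty.symm
  let st : ℕ → State := fun t => next^[t] ⟨⟨0, ∅⟩, h0⟩
  have hst : ∀ t, pgaApprox (target U) (fun t => x (st t)) t =
      stateApprox U e (st t).1.1 (st t).1.2 := by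
    intro t
    induction t with
    | zero => simp [pgaApprox, st, stateApprox, partialTarget]
    | succ t ih =>
      rw [pgaApprox, ih, show st (t + 1) = next (st t) from Function.iterate_succ_apply' _ _ _,
        happ]
  exact ⟨fun t => x (st t), fun t => ⟨hxD _, fun y hy => by rw [hst]; exact hmax _ y hy⟩⟩

lemma exists_state_of_selection (h : IsLevelSystem U e v) (hgD : ∀ l i, levelElement U e l i ∈ D)
    (hD : ∀ (m : ℕ) (S : Finset (Fin (4 ^ m))), S ≠ Finset.univ → ∀ x ∈ D,
      (∃ i ∉ S, x = levelElement U e m i) ∨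
        |inner ℝ (target U - stateApprox U e m S) x| < (5 / 18) ^ m)
    {g : ℕ → H} (hg : IsPGASelection D (target U) g) (t : ℕ) :
    ∃ (m : ℕ) (S : Finset (Fin (4 ^ m))), S ≠ Finset.univ ∧
      ∑ l ∈ Finset.range m, 4 ^ l + S.card = t ∧
      pgaApprox (target U) g t = stateApprox U e m S := by
  induction t with
  | zero =>
    exact ⟨0, ∅, (Finset.univ_nonempty_iff.2 ⟨⟨0, by positivity⟩⟩).ne_empty.symm, by simp,
      by simp [pgaApprox, stateApprox, partialTarget]⟩
  | succ t ih =>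
    obtain ⟨m, S, hS, hcard, happ⟩ := ih
    have hin : ∀ j ∉ S, inner ℝ (target U - stateApprox U e m S) (levelElement U e m j) =
        (5 / 18 : ℝ) ^ m := fun j hj => by
      rw [h.inner_residual_levelElement_level, if_neg hj]
    obtain ⟨hgt, hmax⟩ := hg t
    rw [happ] at hmax
    obtain ⟨i, hi, hgi⟩ : ∃ i ∉ S, g t = levelElement U e m i := by
      refine (hD m S hS _ hgt).resolve_right (not_lt.2 ?_)
      obtain ⟨j, hj⟩ := not_forall.1 (mt Finset.eq_univ_iff_forall.2 hS)
      have := hmax _ (hgD m j)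
      rwa [hin j hj, abs_of_pos (by positivity)] at this
    obtain ⟨m', S', hS', hcard', happ'⟩ := exists_next_state U e hi
    refine ⟨m', S', hS', by rw [hcard', hcard], ?_⟩
    rw [pgaApprox, happ, hgi, hin i hi, happ']

end IsLevelSystem

lemma neg_half_lt_logb : -(1 / 2 : ℝ) < Real.logb 4 (5 / 9) := by
  rw [Real.lt_logb_iff_rpow_lt (by norm_num) (by norm_num), Real.rpow_neg (by norm_num),
    ← Real.sqrt_eq_rpow, show (4 : ℝ) = 2 ^ 2 by norm_num, Real.sqrt_sq (by norm_num)]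
  norm_num

lemma rpow_logb_le {m t : ℕ} (h : 4 ^ m ≤ t) :
    (t : ℝ) ^ Real.logb 4 (5 / 9) ≤ (5 / 9) ^ m := by
  have hneg : Real.logb 4 (5 / 9) ≤ 0 :=
    (Real.logb_neg (by norm_num) (by norm_num) (by norm_num)).le
  have h' : (4 : ℝ) ^ m ≤ t := by exact_mod_cast h
  calc (t : ℝ) ^ Real.logb 4 (5 / 9) ≤ ((4 : ℝ) ^ m) ^ Real.logb 4 (5 / 9) :=
        Real.rpow_le_rpow_of_nonpos (by positivity) h' hneg
    _ = (5 / 9) ^ m := by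
        rw [← Real.rpow_natCast, ← Real.rpow_mul (by norm_num), mul_comm,
          Real.rpow_mul (by norm_num), Real.rpow_logb (by norm_num) (by norm_num) (by norm_num),
          Real.rpow_natCast]

end Dynamics

theorem theorem3 {H : Type*} [NormedAddCommGroup H] [InnerProductSpace ℝ H] [CompleteSpace H]
    [TopologicalSpace.SeparableSpace H] (hH : ¬ FiniteDimensional ℝ H) :
    ∃ (D : Set H) (f₀ : H) (β C : ℝ),
      IsDictionary D ∧ cumulativeCoherence D < ⊤ ∧ f₀ ∈ finiteCombinations D ∧
      0 < β ∧ 0 < C ∧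
      (∃ g : ℕ → H, IsPGASelection D f₀ g) ∧
      ∀ g : ℕ → H, IsPGASelection D f₀ g →
        ∀ m : ℕ, 1 ≤ m → C * (m : ℝ) ^ (-(1 / 2 : ℝ) + β) ≤ ‖f₀ - pgaApprox f₀ g m‖ := by
  obtain ⟨U, e, v, h⟩ := exists_isLevelSystem hH
  obtain ⟨s, hs⟩ : ∃ s : ℝ, s ^ 2 = 815 / 896 := ⟨√(815 / 896), Real.sq_sqrt (by norm_num)⟩
  obtain ⟨B, hB1, hB, hAB, hdense⟩ := exists_orthogonal_completion (coreDictionary U e v s)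
  have hgD : ∀ l i, levelElement U e l i ∈ coreDictionary U e v s ∪ B := fun l i =>
    Or.inl (Or.inl ⟨⟨l, i⟩, rfl⟩)
  have hD : ∀ (m : ℕ) (S : Finset (Fin (4 ^ m))), S ≠ Finset.univ →
      ∀ x ∈ coreDictionary U e v s ∪ B, (∃ i ∉ S, x = levelElement U e m i) ∨
        |inner ℝ (target U - stateApprox U e m S) x| < (5 / 18) ^ m := by
    rintro m S hS x (hx | hx)
    · exact h.eq_levelElement_or_abs_inner_lt hS hx
    · right
      have hmem := Submodule.sub_mem _ (IsLevelSystem.target_mem_span U e v s)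
        (IsLevelSystem.stateApprox_mem_span U e v s m S)
      have hperp : coreDictionary U e v s ⊆ (ℝ ∙ x)ᗮ := fun y hy =>
        Submodule.mem_orthogonal_singleton_iff_inner_left.2 (hAB x hx y hy)
      rw [Submodule.mem_orthogonal_singleton_iff_inner_left.1 (Submodule.span_le.2 hperp hmem),
        abs_zero]
      positivity
  refine ⟨coreDictionary U e v s ∪ B, target U, 1 / 2 + Real.logb 4 (5 / 9), (5 / 9) ^ 2,
    ⟨?_, hdense⟩, ?_, ?_, ?_, by norm_num, h.exists_selection hgD hD, fun g hg t ht => ?_⟩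
  · rintro x (hx | hx)
    · exact h.norm_eq_one_of_mem_coreDictionary hs hx
    · exact hB1 x hx
  · exact (cumulativeCoherence_union_le (fun x hx => h.tsum_coreDictionary_le hs hx) hB).trans_lt
      IsLevelSystem.coherence_bound_lt_top
  · exact Submodule.span_mono Set.subset_union_left (IsLevelSystem.target_mem_span U e v s)
  · linarith [neg_half_lt_logb]
  · obtain ⟨m, S, hS, hcard, happ⟩ := h.exists_state_of_selection hgD hD hg t
    rw [happ, neg_add_cancel_left]
    refine le_trans ?_ (h.le_norm_residual hS)
    rcases m with _ | m
    · have hlt := (Finset.card_lt_iff_ne_univ S).2 hS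
      simp at hlt hcard
      simp [hlt] at hcard
      omega
    · have h4 : 4 ^ m ≤ t := by
        rw [← hcard, Finset.sum_range_succ]
        omega
      calc (5 / 9 : ℝ) ^ 2 * (t : ℝ) ^ Real.logb 4 (5 / 9) ≤ (5 / 9) ^ 2 * (5 / 9) ^ m := by
            gcongr
            exact rpow_logb_le h4
        _ = (5 / 9) ^ (m + 1 + 1) := by ring
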